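/- \textbf{Theorem (Effective Finite Model Property of $\mathrm{ALBO}^{\mathrm{id}}$).} Fix a signature consisting of three disjoint alphabets: individuals $a$, concept symbols $A$ and role symbols $Q$. The concepts $C,D$ and roles $R,S$ of the description logic $\mathrm{ALBO}^{\mathrm{id}}$ are given by the grammar $$C,D ::= A \mid \{a\} \mid \neg C \mid C\sqcup D \mid \exists R.C,\qquad R,S ::= Q \mid R\sqcup S \mid R^{-1} \mid \neg R \mid \mathrm{id}.$$ The length of a concept is the number of symbols in the word that the grammar produces for it; each individual, concept symbol and role symbol and each of $\mathrm{id}$, $\neg$, $\sqcup$, ${}^{-1}$, $\exists$, the dot and the two braces counts as one symbol, and parentheses are not counted. A model $\mathcal I$ consists of a non-empty set $\Delta^{\mathcal I}$, an element $a^{\mathcal I}\in\Delta^{\mathcal I}$ for each individual $a$ (different individuals may denote the same element), a subset $A^{\mathcal I}\subseteq\Delta^{\mathcal I}$ for each concept symbol $A$, and a binary relation $Q^{\mathcal I}\subseteq\Delta^{\mathcal I}\times\Delta^{\mathcal I}$ for each role symbol $Q$. It extends to all expressions by: $\{a\}^{\mathcal I}=\{a^{\mathcal I}\}$; $\sqcup$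 is union; $\neg$ is complement, in $\Delta^{\mathcal I}$ for concepts and in $\Delta^{\mathcal I}\times\Delta^{\mathcal I}$ for roles; $R^{-1}$ is interpreted as the inverse relation of $R^{\mathcal I}$; $\mathrm{id}^{\mathcal I}=\{(x,x)\mid x\in\Delta^{\mathcal I}\}$; and $(\exists R.C)^{\mathcal I}=\{x\mid \exists y\in C^{\mathcal I},\ (x,y)\in R^{\mathcal I}\}$. A concept $C$ is satisfied in $\mathcal I$ if $C^{\mathcal I}\neq\emptyset$, and it is satisfiable if it is satisfied in some model. Let $\mu(n)=3\,(n\lfloor\log_2(n+1)\rfloor)\cdot 2^n$. Then $\mu:\mathbb N\to\mathbb N$ is computable, and every satisfiable $\mathrm{ALBO}^{\mathrm{id}}$ concept of length $n$ is satisfied in a finite model whose domain has at most $\mu(n)$ elements. That is, $\mathrm{ALBO}^{\mathrm{id}}$ has the effective finite model property with model bounding function $\mu$. -/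

import Mathlib

universe u v w x y

namespace ALBO

/-- Role expressions over the alphabet `RN` of role symbols:
`R, S ::= Q | R ⊔ S | R⁻¹ | ¬R | id`. The identity role `id` is a constant of the language. -/
inductive Role (RN : Type w) : Type w
  | sym (Q : RN) : Role RN
  | union (R S : Role RN) : Role RN
  | inv (R : Role RN) : Role RN
  | neg (R : Role RN) : Role RN
  | ident : Role RN

/-- Concept expressions over the signature `(ON, CN, RN)` of individuals, concept symbols and
role symbols: `C, D ::= A | {a} | ¬C | C ⊔ D | ∃R.C`. -/
inductive Concept (ON : Type u) (CN : Type v) (RN : Type w) : Type (max u v w)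
  | sym (A : CN) : Concept ON CN RN
  | singleton (a : ON) : Concept ON CN RN
  | neg (C : Concept ON CN RN) : Concept ON CN RN
  | union (C D : Concept ON CN RN) : Concept ON CN RN
  | ex (R : Role RN) (C : Concept ON CN RN) : Concept ON CN RN

/-- The symbols of which the words of the language consist. Every individual, concept symbol and
role symbol is one symbol; so are `id`, `⁻¹`, both braces and the dot. -/
inductive Letter (ON : Type u) (CN : Type v) (RN : Type w) : Type (max u v w)
  | individual (a : ON) : Letter ON CN RN
  | conceptSym (A : CN) : Letter ON CN RN
  | roleSym (Q : RN) : Letter ON CN RN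
  | ident : Letter ON CN RN
  | neg : Letter ON CN RN
  | union : Letter ON CN RN
  | inv : Letter ON CN RN
  | ex : Letter ON CN RN
  | dot : Letter ON CN RN
  | lbrace : Letter ON CN RN
  | rbrace : Letter ON CN RN

variable {ON : Type u} {CN : Type v} {RN : Type w}

/-- The word of a role, as the grammar spells it. -/
def Role.word : Role RN → List (Letter ON CN RN)
  | .sym Q => [.roleSym Q]
  | .union R S => R.word ++ [.union] ++ S.word
  | .inv R => R.word ++ [.inv]
  | .neg R => [.neg] ++ R.word
  | .ident => [.ident]

/-- The word of a concept, as the grammar spells it. The grammar has no parentheses; words in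
which parentheses are added for readability are at least as long. -/
def Concept.word : Concept ON CN RN → List (Letter ON CN RN)
  | .sym A => [.conceptSym A]
  | .singleton a => [.lbrace, .individual a, .rbrace]
  | .neg C => [.neg] ++ C.word
  | .union C D => C.word ++ [.union] ++ D.word
  | .ex R C => [.ex] ++ R.word ++ [.dot] ++ C.word

/-- The length of a concept: the number of symbols of its word. -/
def Concept.length (C : Concept ON CN RN) : ℕ := C.word.length

/-- A model (interpretation) of the signature `(ON, CN, RN)`. There is no unique name
assumption. -/
structure Interpretation (ON : Type u) (CN : Type v) (RN : Type w) where
  /-- The domain. -/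
  Domain : Type x
  nonempty : Nonempty Domain
  individual : ON → Domain
  conceptSym : CN → Set Domain
  roleSym : RN → Set (Domain × Domain)

namespace Interpretation

/-- The extension of a role. -/
def role (I : Interpretation.{u, v, w, x} ON CN RN) : Role RN → Set (I.Domain × I.Domain)
  | .sym Q => I.roleSym Q
  | .union R S => I.role R ∪ I.role S
  | .inv R => {p | (p.2, p.1) ∈ I.role R}
  | .neg R => (I.role R)ᶜ
  | .ident => {p | p.1 = p.2}

/-- The extension of a concept. -/
def concept (I : Interpretation.{u, v, w, x} ON CN RN) : Concept ON CN RN → Set I.Domain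
  | .sym A => I.conceptSym A
  | .singleton a => {I.individual a}
  | .neg C => (I.concept C)ᶜ
  | .union C D => I.concept C ∪ I.concept D
  | .ex R C => {s | ∃ t ∈ I.concept C, (s, t) ∈ I.role R}

/-- The concept `C` is satisfied in the model `I`. -/
def Satisfies (I : Interpretation.{u, v, w, x} ON CN RN) (C : Concept ON CN RN) : Prop :=
  (I.concept C).Nonempty

end Interpretation

/-- The concept `C` is satisfiable: it is satisfied in some model (with domain in `Type x`). -/
def Concept.Satisfiable (C : Concept ON CN RN) : Prop :=
  ∃ I : Interpretation.{u, v, w, x} ON CN RN, I.Satisfies C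

/-- The logic over the signature `(ON, CN, RN)` has the effective finite model property with
model bounding function `f`: `f` is computable, and every satisfiable concept of length `n` is
satisfied in a finite model with at most `f n` elements. Satisfiability is with respect to models
in any universe `x`, and the finite model can be found in any universe `y`. -/
def HasEffectiveFMPWith (ON : Type u) (CN : Type v) (RN : Type w) (f : ℕ → ℕ) : Prop :=
  Computable f ∧
    ∀ C : Concept ON CN RN, Concept.Satisfiable.{u, v, w, x} C →
      ∃ J : Interpretation.{u, v, w, y} ON CN RN,
        Finite J.Domain ∧ Nat.card J.Domain ≤ f C.length ∧ J.Satisfies C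

/-- The function `μ(n) = 3 (n ⌊log₂ (n + 1)⌋) 2ⁿ`. -/
def mu (n : ℕ) : ℕ := 3 * (n * Nat.log 2 (n + 1)) * 2 ^ n

end ALBO

/-!
The proof adapts the argument of Grädel, Kolaitis and Vardi for two-variable first-order logic.
Roles have no composition, so whether `x` satisfies a concept depends only on which pairs `(x, y)`
occur; a model can therefore be rebuilt from copies of pairs of a given model `I` of `C`.

The type of a point of `I` is the set of subconcepts of `C` that hold there. In a new domain `J`,
each ordered pair `x, y` is declared to look like a pair of points `copy x y, copy y x` of `I`,
where the type of `copy x y` depends on `x` only and `copy x y = copy y x` exactly if `x = y`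
(`Patchwork`). Such a `J` satisfies at `x` the same subconcepts of `C` as `I` satisfies at
`copy x x`, as soon as every existential subconcept true at `copy x x` has a witness seen from `x`
(`Patchwork.mem_concept_iff`). Negated existentials hold automatically, since every pair of `J` is
a copy of a pair of `I` with the same types, and a nominal of `C` keeps its unique bearer, since a
type with a single bearer in `I`, a king, is the type of exactly one point of `J`.

A finite patchwork (`Patchwork.exists_finite`) consists of points carrying one of three levels.
A point that is not a king finds its non-royal witnesses at the next level modulo three, at
points set aside for the type of the witness and the existential. Hence no
unordered pair of points is asked to copy two different pairs, and pairs on which nothing is asked copy any two distinct points of the right types. With `r`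
subconcepts and `s` existentials there are at most `3 (s + 1)² 2 ^ r` points. As an existential
contributes at least three letters to the word of a concept and one to `r`, the length is at least
`r + 2 s`, and `(s + 1)² ≤ 4 ^ s` leaves at most `3 * 2 ^ n` points.
-/

namespace ALBO

/-! ### Computability of the bound -/

theorem primrec_nat_pow : Primrec₂ ((· ^ ·) : ℕ → ℕ → ℕ) :=
  Primrec₂.unpaired'.1 Nat.Primrec.pow

theorem primrec_log_two : Primrec (Nat.log 2) := by
  have hp : PrimrecRel fun n k : ℕ => 2 ^ k ≤ n :=
    Primrec.nat_le.comp (primrec_nat_pow.comp (Primrec.const 2) Primrec.snd) Primrec.fst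
  refine (Primrec.nat_findGreatest Primrec.id hp).of_eq fun n => ?_
  rcases Nat.eq_zero_or_pos n with rfl | hn
  · simp
  · refine le_antisymm ?_ ?_
    · exact Nat.le_log_of_pow_le one_lt_two
        (Nat.findGreatest_spec (P := fun k => 2 ^ k ≤ n) (m := 0) (Nat.zero_le _) hn)
    · exact Nat.le_findGreatest (Nat.log_le_self 2 n) (Nat.pow_log_le_self 2 hn.ne')

theorem primrec_mu : Primrec mu :=
  Primrec.nat_mul.comp
    (Primrec.nat_mul.comp (Primrec.const 3)
      (Primrec.nat_mul.comp Primrec.id (primrec_log_two.comp Primrec.succ)))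
    (primrec_nat_pow.comp (Primrec.const 2) Primrec.id)

/-! ### Patchworks of pairs -/

/-- A prescription of which pairs of points of `Δ` the pairs of points of `J` are to copy: the pair
`(x, y)` copies `(copy x y, copy y x)`. The point `x` itself stands for `copy x x`. Here `τ` assigns
types to the points of `Δ`, and `wit d i` is a point that every `x` standing for `d` must see. -/
structure Patchwork {Δ T S : Type*} (τ : Δ → T) (wit : Δ → S → Δ) (J : Type*) where
  copy : J → J → Δ
  type_copy (x y : J) : τ (copy x y) = τ (copy x x)
  copy_ne {x y : J} : x ≠ y → copy x y ≠ copy y x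
  exists_wit (x : J) (i : S) : ∃ y, copy x y = copy x x ∧ copy y x = wit (copy x x) i
  exists_type (d : Δ) : ∃ x, τ (copy x x) = τ d

/-- A king is a point that is the only one of its type. -/
def IsKing {Δ T : Type*} (τ : Δ → T) (d : Δ) : Prop := ∀ e, τ e = τ d → e = d

theorem IsKing.of_type_eq {Δ T : Type*} {τ : Δ → T} {d e : Δ} (h : IsKing τ d)
    (he : τ e = τ d) : IsKing τ e :=
  h e he ▸ h

namespace Patchwork

theorem exists_eq_of_isKing {Δ T S J : Type*} {τ : Δ → T} {wit : Δ → S → Δ}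
    (P : Patchwork τ wit J) {d : Δ} (hd : IsKing τ d) : ∃ x, P.copy x x = d :=
  (P.exists_type d).imp fun _ hx => hd _ hx

theorem eq_of_isKing {Δ T S J : Type*} {τ : Δ → T} {wit : Δ → S → Δ}
    (P : Patchwork τ wit J) {x y : J} (hx : IsKing τ (P.copy x x))
    (hxy : P.copy y y = P.copy x x) : y = x := by
  by_contra hne
  refine P.copy_ne hne ?_
  rw [hx (P.copy y x) (by rw [P.type_copy, hxy]), hx (P.copy x y) (P.type_copy x y)]

end Patchwork

/-- If every pair of distinct points admits a pair of values, the admissible values can be chosen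
in a way that does not depend on the order of the two points. -/
theorem exists_symmetric_choice {J Δ : Type*} [Nonempty Δ] (P : J → J → Δ → Δ → Prop)
    (symm : ∀ x y a b, P x y a b → P y x b a) (h : ∀ x y, x ≠ y → ∃ a b, P x y a b) (p : J → Δ) :
    ∃ q : J → J → Δ, (∀ x, q x x = p x) ∧ ∀ x y, x ≠ y → P x y (q x y) (q y x) := by
  classical
  choose! f g hfg using h
  let _ : LinearOrder J := linearOrderOfSTO WellOrderingRel
  refine ⟨fun x y => if x = y then p x else if x < y then f x y else g y x, by simp, ?_⟩
  intro x y hxy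
  rcases lt_or_gt_of_ne hxy with hlt | hlt
  · simpa [hxy, hxy.symm, hlt, hlt.not_gt] using hfg x y hxy
  · simpa [hxy, hxy.symm, hlt, hlt.not_gt] using symm _ _ _ _ (hfg y x hxy.symm)

/-- An address `(t, o, i, j)` from which a finite patchwork is built. It stands for the chosen point
of type `t` if `o = none`, and for the `k`-th witness of that point if `o = some k`. The entries
`i` and `j` only serve to keep several points apart: `i` says for which witness the point is
intended, and `j` is its level. -/
abbrev Address (T S : Type*) := T × Option S × Option S × ZMod 3

/-- The point of `Δ` for which an address stands, where `rep` chooses a point of each type. -/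
def Address.point {Δ T S : Type*} (rep : T → Δ) (wit : Δ → S → Δ) (x : Address T S) : Δ :=
  x.2.1.elim (rep x.1) (wit (rep x.1))

/-- A pair with a king always copies the two points for which its members stand, so a king sees its
`k`-th witness at the address `(t, some k, none, 0)`, where `t` is the type of the king. Only
pairs of distinct points without a king may copy something else. -/
theorem Patchwork.exists_finite {Δ : Type*} [Nonempty Δ] {T S : Type} [Fintype T] [Fintype S]
    (τ : Δ → T) (wit : Δ → S → Δ) :
    ∃ (J : Type y) (_ : Patchwork τ wit J), Finite J ∧
      Nat.card J ≤ 3 * (Fintype.card S + 1) ^ 2 * Fintype.card T := by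
  classical
  have ⟨rep, hrep⟩ : ∃ rep : T → Δ, ∀ d, τ (rep (τ d)) = τ d :=
    ⟨Function.invFun τ, fun d => Function.invFun_eq ⟨d, rfl⟩⟩
  have rep_king {d : Δ} (hd : IsKing τ d) : rep (τ d) = d := hd _ (hrep d)
  let pt : Address T S → Δ := Address.point rep wit
  -- A king is represented at one address only, so that no second point has its type.
  let J : Type y := {x : ULift.{y} (Address T S) //
    IsKing τ (pt x.down) → x.down = (τ (pt x.down), none, none, 0)}
  let p : J → Δ := fun x => pt x.1.down
  have king_inj {x y : J} (hx : IsKing τ (p x)) (h : τ (p y) = τ (p x)) : x = y := by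
    have hy : p y = p x := hx _ h
    refine Subtype.ext (ULift.down_injective ?_)
    rw [x.2 hx, y.2 (hx.of_type_eq h)]
    change (τ (p x), _) = (τ (p y), _)
    rw [hy]
  -- `y` is the point intended as the `i`-th witness of `x`, when neither is royal.
  let asks (x y : J) (i : S) : Prop :=
    ¬ IsKing τ (p x) ∧ wit (p x) i ≠ p x ∧
      y.1.down = (τ (wit (p x) i), none, some i, x.1.down.2.2.2 + 1)
  have asks_type {x y : J} {i : S} (h : asks x y i) : τ (p y) = τ (wit (p x) i) := by
    change τ (pt y.1.down) = _
    rw [h.2.2]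
    exact hrep _
  have asks_asymm {x y : J} {i k : S} (h : asks x y i) (h' : asks y x k) : False := by
    have h1 : y.1.down.2.2.2 = x.1.down.2.2.2 + 1 := by rw [h.2.2]
    have h2 : x.1.down.2.2.2 = y.1.down.2.2.2 + 1 := by rw [h'.2.2]
    -- Modulo three, no two levels succeed each other.
    revert h1 h2
    generalize y.1.down.2.2.2 = a
    generalize x.1.down.2.2.2 = b
    revert a b
    decide
  have asks_inj {x y : J} {i k : S} (h : asks x y i) (h' : asks x y k) : i = k := by
    have := h.2.2.symm.trans h'.2.2
    simpa using congrArg (fun z : Address T S => z.2.2.1) this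
  have ⟨q, hq, hP⟩ := exists_symmetric_choice
    (fun (x y : J) (a b : Δ) => τ a = τ (p x) ∧ τ b = τ (p y) ∧ a ≠ b ∧
      (p x ≠ p y → (IsKing τ (p x) ∨ IsKing τ (p y)) → a = p x ∧ b = p y) ∧
      (∀ i, asks x y i → ¬ IsKing τ (p y) → a = p x ∧ b = wit (p x) i) ∧
      (∀ i, asks y x i → ¬ IsKing τ (p x) → b = p y ∧ a = wit (p y) i))
    (fun x y a b ⟨h1, h2, h3, h4, h5, h6⟩ =>
      ⟨h2, h1, h3.symm, fun h h' => (h4 h.symm h'.symm).symm, h6, h5⟩)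
    (by
      intro x y hxy
      by_cases hking : IsKing τ (p x) ∨ IsKing τ (p y)
      · have hne : p x ≠ p y := by
          intro h
          rcases hking with hk | hk
          · exact hxy (king_inj hk (by rw [h]))
          · exact hxy (king_inj hk (by rw [h])).symm
        exact ⟨p x, p y, rfl, rfl, hne, fun _ _ => ⟨rfl, rfl⟩,
          fun i h h' => absurd hking (by tauto), fun i h h' => absurd hking (by tauto)⟩
      · by_cases h1 : ∃ i, asks x y i
        · obtain ⟨i, hi⟩ := h1
          refine ⟨p x, wit (p x) i, rfl, (asks_type hi).symm, hi.2.1.symm,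
            fun _ h => absurd h hking, fun k hk _ => ⟨rfl, ?_⟩,
            fun k hk => (asks_asymm hi hk).elim⟩
          rw [asks_inj hi hk]
        · by_cases h2 : ∃ i, asks y x i
          · obtain ⟨i, hi⟩ := h2
            refine ⟨wit (p y) i, p y, (asks_type hi).symm, rfl, hi.2.1,
              fun _ h => absurd h hking, fun k hk => (asks_asymm hi hk).elim,
              fun k hk _ => ⟨rfl, ?_⟩⟩
            rw [asks_inj hi hk]
          · -- Nothing is asked: any two distinct points of the right types will do.
            have ⟨b, hb, hne⟩ : ∃ b, τ b = τ (p y) ∧ b ≠ p x := by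
              by_cases h : p x = p y
              · have : ¬ IsKing τ (p y) := fun h => hking (Or.inr h)
                simp only [IsKing, not_forall] at this
                obtain ⟨b, hb, hne⟩ := this
                exact ⟨b, hb, h ▸ hne⟩
              · exact ⟨p y, rfl, Ne.symm h⟩
            exact ⟨p x, b, rfl, hb, hne.symm, fun _ h => absurd h hking,
              fun i hi => (h1 ⟨i, hi⟩).elim, fun i hi => (h2 ⟨i, hi⟩).elim⟩)
    p
  refine ⟨J, ⟨q, ?_, ?_, ?_, ?_⟩, inferInstance, ?_⟩
  · intro x y
    by_cases hxy : x = y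
    · rw [hxy]
    · rw [hq, (hP x y hxy).1]
  · exact fun {x y} hxy => (hP x y hxy).2.2.1
  · intro x i
    rw [hq]
    by_cases hself : wit (p x) i = p x
    · exact ⟨x, by rw [hq, hself]; exact ⟨rfl, rfl⟩⟩
    by_cases hb : IsKing τ (wit (p x) i)
    · have hpt : pt (τ (wit (p x) i), none, none, 0) = wit (p x) i := rep_king hb
      let y : J := ⟨⟨_⟩, fun _ => by rw [hpt]⟩
      have hy : p y = wit (p x) i := hpt
      have hxy : x ≠ y := fun h => hself (by rw [← hy, ← h])
      have := (hP x y hxy).2.2.2.1 (by rw [hy]; exact Ne.symm hself) (Or.inr (hy ▸ hb))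
      exact ⟨y, this.1, this.2.trans hy⟩
    by_cases ha : IsKing τ (p x)
    · have hpt : pt (τ (p x), some i, none, 0) = wit (p x) i := by
        change wit (rep (τ (p x))) i = _
        rw [rep_king ha]
      let y : J := ⟨⟨_⟩, fun h => absurd (hpt ▸ h) hb⟩
      have hy : p y = wit (p x) i := hpt
      have hxy : x ≠ y := fun h => hself (by rw [← hy, ← h])
      have := (hP x y hxy).2.2.2.1 (by rw [hy]; exact Ne.symm hself) (Or.inl ha)
      exact ⟨y, this.1, this.2.trans hy⟩
    · have hpt : τ (pt (τ (wit (p x) i), none, some i, x.1.down.2.2.2 + 1)) = τ (wit (p x) i) :=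
        hrep _
      let y : J := ⟨⟨_⟩, fun h => absurd (h.of_type_eq hpt.symm) hb⟩
      have hask : asks x y i := ⟨ha, hself, rfl⟩
      have hxy : x ≠ y := by
        intro h
        have hself : asks x x i := (congrArg (asks x · i) h).mpr hask
        exact asks_asymm hself hself
      have := (hP x y hxy).2.2.2.2.1 i hask (fun h => hb (h.of_type_eq hpt.symm))
      exact ⟨y, this⟩
  · intro d
    have hpt : τ (pt (τ d, none, none, 0)) = τ d := hrep d
    exact ⟨⟨⟨_⟩, fun _ => by rw [hpt]⟩, by rw [hq]; exact hpt⟩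
  · calc Nat.card J ≤ Nat.card (ULift.{y} (Address T S)) :=
          Nat.card_le_card_of_injective _ Subtype.val_injective
      _ = 3 * (Fintype.card S + 1) ^ 2 * Fintype.card T := by
          simp [Nat.card_eq_fintype_card, ZMod.card]
          ring

/-! ### Subconcepts -/

variable {ON : Type u} {CN : Type v} {RN : Type w}

/-- The subconcepts of a concept, one entry for each occurrence. -/
def Concept.subconcepts : Concept ON CN RN → List (Concept ON CN RN)
  | .sym A => [.sym A]
  | .singleton a => [.singleton a]
  | .neg C => .neg C :: C.subconcepts
  | .union C D => .union C D :: (C.subconcepts ++ D.subconcepts)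
  | .ex R C => .ex R C :: C.subconcepts

/-- The pairs `(R, D)` for which `∃R.D` is a subconcept, one entry for each occurrence. -/
def Concept.existentials : Concept ON CN RN → List (Role RN × Concept ON CN RN)
  | .sym _ => []
  | .singleton _ => []
  | .neg C => C.existentials
  | .union C D => C.existentials ++ D.existentials
  | .ex R C => (R, C) :: C.existentials

theorem Concept.mem_subconcepts_self (C : Concept ON CN RN) : C ∈ C.subconcepts := by
  cases C <;> simp [subconcepts]

theorem Role.one_le_length_word (R : Role RN) :
    1 ≤ (R.word : List (Letter ON CN RN)).length := by
  cases R <;> simp only [word, List.length_append, List.length_singleton] <;> omega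

/-- An existential takes at least three letters besides those of its argument, one of which pays for
the existential as a subconcept. -/
theorem Concept.length_subconcepts_add_le (C : Concept ON CN RN) :
    C.subconcepts.length + 2 * C.existentials.length ≤ C.length := by
  induction C with
  | sym A => simp [subconcepts, existentials, length, word]
  | singleton a => simp [subconcepts, existentials, length, word]
  | neg C ih => simp [subconcepts, existentials, length, word] at ih ⊢; omega
  | union C D ihC ihD => simp [subconcepts, existentials, length, word] at ihC ihD ⊢; omega
  | ex R C ih =>
    have := R.one_le_length_word (ON := ON) (CN := CN)
    simp [subconcepts, existentials, length, word] at ih ⊢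
    omega

/-! ### The model on a patchwork -/

namespace Interpretation

variable (I : Interpretation.{u, v, w, x} ON CN RN) (C : Concept ON CN RN)

/-- The type of a point with respect to `C`: the positions in the list of subconcepts of `C` at
which there is a concept true at that point. -/
def typeOf (d : I.Domain) : Set (Fin C.subconcepts.length) :=
  {i | d ∈ I.concept (C.subconcepts.get i)}

open Classical in
/-- For the `i`-th existential `∃R.D` of `C`, an `R`-successor of `d` in `D`, or `d` itself if there
is none. -/
noncomputable def witness (d : I.Domain) (i : Fin C.existentials.length) : I.Domain :=
  if h : ∃ t ∈ I.concept (C.existentials.get i).2, (d, t) ∈ I.role (C.existentials.get i).1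
  then h.choose else d

variable {I C}

theorem mem_concept_iff_of_typeOf_eq {d e : I.Domain} (h : I.typeOf C d = I.typeOf C e)
    {D : Concept ON CN RN} (hD : D ∈ C.subconcepts) : d ∈ I.concept D ↔ e ∈ I.concept D := by
  obtain ⟨i, rfl⟩ := List.get_of_mem hD
  exact Set.ext_iff.1 h i

theorem exists_witness {R : Role RN} {D : Concept ON CN RN} (h : (R, D) ∈ C.existentials)
    {d : I.Domain} (hd : d ∈ I.concept (.ex R D)) :
    ∃ i, I.witness C d i ∈ I.concept D ∧ (d, I.witness C d i) ∈ I.role R := by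
  obtain ⟨i, hi⟩ := List.get_of_mem h
  have hd' : ∃ t ∈ I.concept (C.existentials.get i).2,
      (d, t) ∈ I.role (C.existentials.get i).1 := by rw [hi]; exact hd
  refine ⟨i, ?_⟩
  have hspec := hd'.choose_spec
  rw [witness, dif_pos hd']
  generalize hd'.choose = t at hspec ⊢
  rwa [hi] at hspec

/-- The bearer of a nominal of `C` is a king. -/
theorem isKing_individual {a : ON} (ha : .singleton a ∈ C.subconcepts) :
    IsKing (I.typeOf C) (I.individual a) := fun _ he =>
  (mem_concept_iff_of_typeOf_eq he ha).2 rfl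

end Interpretation

namespace Patchwork

variable {I : Interpretation.{u, v, w, x} ON CN RN} {C : Concept ON CN RN} {J : Type y}
  (P : Patchwork (I.typeOf C) (I.witness C) J) [Nonempty J]

/-- The model on a patchwork in which every pair has the roles of the pair that it copies. An
individual denotes a point that stands for its denotation in `I`, if there is one; this is the case
for the individuals that occur in `C`. -/
noncomputable def model : Interpretation.{u, v, w, y} ON CN RN where
  Domain := J
  nonempty := inferInstance
  individual a := Function.invFun (fun x => P.copy x x) (I.individual a)
  conceptSym A := {x | P.copy x x ∈ I.conceptSym A}
  roleSym Q := {z | (P.copy z.1 z.2, P.copy z.2 z.1) ∈ I.roleSym Q}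

theorem mem_role_iff (R : Role RN) (x y : J) :
    (x, y) ∈ P.model.role R ↔ (P.copy x y, P.copy y x) ∈ I.role R := by
  induction R generalizing x y with
  | sym Q => rfl
  | union R S ihR ihS => exact or_congr (ihR x y) (ihS x y)
  | inv R ih => exact ih y x
  | neg R ih => exact not_congr (ih x y)
  | ident =>
    change x = y ↔ P.copy x y = P.copy y x
    exact ⟨fun h => by rw [h], fun h => by_contra fun hne => P.copy_ne hne h⟩

theorem copy_individual {a : ON} (ha : .singleton a ∈ C.subconcepts) :
    P.copy (P.model.individual a) (P.model.individual a) = I.individual a :=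
  Function.invFun_eq (P.exists_eq_of_isKing (Interpretation.isKing_individual ha))

theorem mem_concept_iff (D : Concept ON CN RN) (hs : D.subconcepts ⊆ C.subconcepts)
    (he : D.existentials ⊆ C.existentials) (x : J) :
    x ∈ P.model.concept D ↔ P.copy x x ∈ I.concept D := by
  induction D generalizing x with
  | sym A => rfl
  | singleton a =>
    have ha := hs (Concept.mem_subconcepts_self _)
    have hc := P.copy_individual ha
    change x = P.model.individual a ↔ P.copy x x = I.individual a
    refine ⟨fun h => by rw [h, hc], fun h => P.eq_of_isKing ?_ (h.trans hc.symm)⟩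
    rw [hc]
    exact Interpretation.isKing_individual ha
  | neg D ih =>
    simp only [Concept.subconcepts, Concept.existentials, List.cons_subset] at hs he
    exact not_congr (ih hs.2 he x)
  | union D E ihD ihE =>
    simp only [Concept.subconcepts, Concept.existentials, List.cons_subset,
      List.append_subset] at hs he
    exact or_congr (ihD hs.2.1 he.1 x) (ihE hs.2.2 he.2 x)
  | ex R D ih =>
    simp only [Concept.subconcepts, Concept.existentials, List.cons_subset] at hs he
    have ih := ih hs.2 he.2
    have hD := hs.2 (Concept.mem_subconcepts_self D)
    constructor
    · rintro ⟨y, hy, hxy⟩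
      rw [← Interpretation.mem_concept_iff_of_typeOf_eq (P.type_copy x y) hs.1]
      exact ⟨P.copy y x,
        (Interpretation.mem_concept_iff_of_typeOf_eq (P.type_copy y x) hD).2 ((ih y).1 hy),
        (P.mem_role_iff R x y).1 hxy⟩
    · intro hx
      obtain ⟨i, hiD, hiR⟩ := Interpretation.exists_witness he.1 hx
      obtain ⟨y, hxy, hyx⟩ := P.exists_wit x i
      refine ⟨y, (ih y).2 ?_, (P.mem_role_iff R x y).2 (by rwa [hxy, hyx])⟩
      rw [← Interpretation.mem_concept_iff_of_typeOf_eq (P.type_copy y x) hD, hyx]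
      exact hiD

end Patchwork

/-! ### The size of the model -/

theorem three_mul_sq_mul_two_pow_le_mu {n r s : ℕ} (hn : 1 ≤ n) (h : r + 2 * s ≤ n) :
    3 * (s + 1) ^ 2 * 2 ^ r ≤ mu n :=
  have hlog : 1 ≤ n * Nat.log 2 (n + 1) :=
    Nat.mul_pos hn (Nat.log_pos one_lt_two (by omega))
  have hs : s + 1 ≤ 2 ^ s := Nat.lt_two_pow_self
  calc 3 * (s + 1) ^ 2 * 2 ^ r ≤ 3 * (2 ^ s) ^ 2 * 2 ^ r := by gcongr
    _ = 3 * 1 * 2 ^ (r + 2 * s) := by ring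
    _ ≤ 3 * (n * Nat.log 2 (n + 1)) * 2 ^ n := by gcongr; exact one_le_two

theorem Concept.one_le_length (C : Concept ON CN RN) : 1 ≤ C.length := by
  have h := C.length_subconcepts_add_le
  have := List.length_pos_of_mem C.mem_subconcepts_self
  omega

end ALBO

theorem mainTheorem3 (ON : Type u) (CN : Type v) (RN : Type w) :
    ALBO.HasEffectiveFMPWith.{u, v, w, x, y} ON CN RN ALBO.mu := by
  refine ⟨ALBO.primrec_mu.to_comp, ?_⟩
  rintro C ⟨I, d, hd⟩
  have := I.nonempty
  obtain ⟨J, P, hfin, hcard⟩ :=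
    ALBO.Patchwork.exists_finite.{y} (I.typeOf C) (I.witness C)
  obtain ⟨x, hx⟩ := P.exists_type d
  have : Nonempty J := ⟨x⟩
  refine ⟨P.model, hfin, ?_, x, ?_⟩
  · refine hcard.trans ?_
    simpa using
      ALBO.three_mul_sq_mul_two_pow_le_mu C.one_le_length C.length_subconcepts_add_le
  · exact (P.mem_concept_iff C (List.Subset.refl _) (List.Subset.refl _) x).2
      ((ALBO.Interpretation.mem_concept_iff_of_typeOf_eq hx C.mem_subconcepts_self).2 hd)
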